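/- All C*-algebras and $*$-homomorphisms are unital; all graphs are finite and simple. A \emph{magic unitary} is a square matrix of projections in which distinct entries of a same row or of a same column are orthogonal and every row and every column sums to $1$. For a finite graph $X$ with adjacency matrix $d_X$, let $A(X)$ be the universal C*-algebra generated by the entries of a magic unitary $u=(u_{ij})_{i,j\in X}$ subject to $d_Xu=ud_X$ (the C*-algebra of the quantum automorphism group of $X$). For finite graphs $X$, $Y$, let $A(X)*_wA(Y)$ be the free wreath product: the quotient of the C*-algebraic free product $A(X)^{*Y}*A(Y)$ (one copy of $A(X)$ for each vertex of $Y$, with canonical maps $\nu_a:A(X)\to A(X)^{*Y}$, $a\in Y$) by the relations $\nu_a(x)v_{ab}=v_{ab}\nu_a(x)$ for $x\in A(X)$ and $a,b\in Y$, where $v=(v_{ab})$ is the generating magic unitary of $A(Y)$. The lexicographic product $X\circ Y$ has vertex set $X\times Y$, with $(i,a)\sim(j,b)$ if and only if ($a=b$ and $i\sim j$) or $a\sim b$. Write $\mathcal V(y)$ for the set of neighbours of $y$ in $Y$, $X^c$ for the complement of $X$, and $$S_Y=\{(y_0,y_1)\in Y^2 : \mathcal V(y_0)=\mathcal V(y_1),\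 y_0\neq y_1\},\qquad T_Y=\{(y_0,y_1)\in Y^2 : \mathcal V(y_0)\cup\{y_0\}=\mathcal V(y_1)\cup\{y_1\},\ y_0\neq y_1\}.$$ \textbf{Theorem.} Let $X$ and $Y$ be finite graphs (for instance, finite regular graphs) such that $A(X\circ Y)\cong A(X)*_wA(Y)$ as C*-algebras (in particular, this holds if they are isomorphic as Woronowicz algebras). Then: \begin{enumerate} \item $\mathrm{Aut}(X\circ Y)\cong\mathrm{Aut}(X)\wr\mathrm{Aut}(Y)$, where the wreath product is the semidirect product $\mathrm{Aut}(X)^{Y}\rtimes\mathrm{Aut}(Y)$ for the action $(\tau\cdot\sigma)_a=\sigma_{\tau^{-1}(a)}$; more precisely, the canonical homomorphism $\mathrm{Aut}(X)\wr\mathrm{Aut}(Y)\to\mathrm{Aut}(X\circ Y)$ sending $(\sigma,\tau)$ to $(i,a)\mapsto(\sigma_{\tau(a)}(i),\tau(a))$ is an isomorphism; \item if $S_Y\neq\emptyset$, then $X$ is connected; \item if $T_Y\neq\emptyset$, then $X^c$ is connected. \end{enumerate} -/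

import Mathlib

open scoped ENNReal

universe u v w

/-! ### Universal C⋆-algebras -/

/-- A system of relations between elements `ρ x` (`x : G`) of a unital C⋆-algebra which bounds the
norm of each `ρ x`, so that the universal unital C⋆-algebra with these generators and relations
exists. (A C⋆-algebra generated by a family indexed by `G : Type u` always has a copy in `Type u`,
so the C⋆-algebras of this universe are all that has to be considered.) -/
structure CStarRelations (G : Type u) where
  /-- The family `ρ` satisfies the relations. -/
  Holds : ∀ (C : Type u) [CStarAlgebra C], (G → C) → Prop
  bounded : ∀ x : G, ∃ K : ℝ, ∀ (C : Type u) [CStarAlgebra C] (ρ : G → C),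
    Holds C ρ → ‖ρ x‖ ≤ K

namespace CStarRelations

variable {G : Type u} (R : CStarRelations G)

/-- A realization of the relations in a nonzero unital C⋆-algebra. -/
structure Realization where
  /-- The target C⋆-algebra. -/
  C : Type u
  [inst : CStarAlgebra C]
  [nontriv : Nontrivial C]
  /-- The images of the generators. -/
  ρ : G → C
  holds : R.Holds C ρ

attribute [instance] Realization.inst Realization.nontriv

/-- The `ℓ^∞`-product of the targets of all realizations. -/
abbrev Ambient : Type (u + 1) := lp (fun r : R.Realization => r.C) ∞

noncomputable instance : CStarAlgebra R.Ambient where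

/-- The family `(ρ x)_ρ` over all realizations `ρ`. -/
noncomputable def ambientGen (x : G) : R.Ambient :=
  ⟨fun r => r.ρ x, memℓp_infty (by
    obtain ⟨K, hK⟩ := R.bounded x
    refine ⟨K, ?_⟩
    rintro _ ⟨r, rfl⟩
    exact hK r.C r.ρ r.holds)⟩

/-- The universal unital C⋆-algebra with generators `G` and relations `R`: the C⋆-algebra generated
by the generators in the product of all realizations. Equivalently, it is the completion of the free
unital `*`-algebra on `G` for the largest C⋆-seminorm coming from realizations of `R`. -/
noncomputable def universalAlgebra : StarSubalgebra ℂ R.Ambient :=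
  (StarAlgebra.adjoin ℂ (Set.range R.ambientGen)).topologicalClosure

/-- The universal C⋆-algebra as a type. -/
abbrev Universal : Type (u + 1) := R.universalAlgebra

noncomputable instance : CStarAlgebra R.Universal :=
  StarSubalgebra.cstarAlgebra R.universalAlgebra
    (h_closed := StarSubalgebra.isClosed_topologicalClosure _)

/-- The canonical generators of the universal C⋆-algebra. -/
noncomputable def gen (x : G) : R.Universal :=
  ⟨R.ambientGen x, StarSubalgebra.le_topologicalClosure _
    (StarAlgebra.subset_adjoin ℂ _ (Set.mem_range_self x))⟩

end CStarRelations

/-! ### Magic unitaries and the quantum automorphism algebra of a graph -/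

/-- A magic unitary: a square matrix of projections, distinct entries of one row or of one column
being orthogonal, all of whose rows and columns sum to `1`. -/
structure IsMagicUnitary {n : Type*} [Fintype n] {C : Type*} [CStarAlgebra C]
    (m : Matrix n n C) : Prop where
  proj : ∀ i j, IsStarProjection (m i j)
  row_orth : ∀ i j k, j ≠ k → m i j * m i k = 0
  col_orth : ∀ i j k, i ≠ j → m i k * m j k = 0
  row_sum : ∀ i, ∑ j, m i j = 1
  col_sum : ∀ j, ∑ i, m i j = 1

open Classical in
/-- The relations on `(u i j)` saying that `u` is a magic unitary commuting with the adjacency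
matrix of `X`. -/
noncomputable def graphRelations {V : Type u} [Fintype V] (X : SimpleGraph V) :
    CStarRelations (V × V) where
  Holds C _ ρ := IsMagicUnitary (Matrix.of fun i j => ρ (i, j)) ∧
    X.adjMatrix C * (Matrix.of fun i j => ρ (i, j)) =
      (Matrix.of fun i j => ρ (i, j)) * X.adjMatrix C
  bounded x := ⟨1, fun _ _ _ h => (h.1.proj x.1 x.2).norm_le⟩

/-- The C⋆-algebra `A(X) = C(𝔾_X)` of the quantum automorphism group of the finite graph `X`. -/
abbrev QAut {V : Type u} [Fintype V] (X : SimpleGraph V) : Type (u + 1) :=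
  (graphRelations X).Universal

/-- The generating magic unitary of `A(X)`. -/
noncomputable def QAut.u {V : Type u} [Fintype V] (X : SimpleGraph V) :
    Matrix V V (QAut X) :=
  Matrix.of fun i j => (graphRelations X).gen (i, j)

/-! ### Free wreath products -/

/-- The relations of the free wreath product of `A` by an algebra `H` generated by a magic unitary
`m` of size `n`: the elements `(k, a)`, `a : A`, form the image of `a` under a unital
`*`-homomorphism `ν k : A → C` for each `k : n`, the elements of `H` are sent to `C` by a unital
`*`-homomorphism `μ` (so far these are the relations of the free product `A^{*n} * H`), and
`ν k a` commutes with `μ (m k i)`. -/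
noncomputable def freeWreathRelations (A : Type u) [CStarAlgebra A] {n : Type w} {H : Type v} [CStarAlgebra H]
    (m : Matrix n n H) : CStarRelations ((n × A) ⊕ H) where
  Holds C _ ρ := ∃ (ν : n → (A →⋆ₐ[ℂ] C)) (μ : H →⋆ₐ[ℂ] C),
    (∀ k a, ρ (Sum.inl (k, a)) = ν k a) ∧ (∀ h, ρ (Sum.inr h) = μ h) ∧
      ∀ (k i : n) (a : A), ν k a * μ (m k i) = μ (m k i) * ν k a
  bounded := by
    rintro (⟨k, a⟩ | h)
    · refine ⟨‖a‖, ?_⟩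
      rintro C _ ρ ⟨ν, μ, h₁, -, -⟩
      rw [h₁]
      exact NonUnitalStarAlgHom.norm_apply_le (ν k) a
    · refine ⟨‖h‖, ?_⟩
      rintro C _ ρ ⟨ν, μ, -, h₂, -⟩
      rw [h₂]
      exact NonUnitalStarAlgHom.norm_apply_le μ h

/-- The free wreath product `A *_w H`, where `m` is the generating magic unitary of `H`. -/
abbrev FreeWreath (A : Type u) [CStarAlgebra A] {n : Type w} {H : Type v} [CStarAlgebra H]
    (m : Matrix n n H) : Type (max u v w + 1) :=
  (freeWreathRelations A m).Universal

/-! ### Graphs -/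

namespace SimpleGraph

/-- The lexicographic product `X ∘ Y`: a copy of `X` at each vertex of `Y`. -/
def lexProd {V : Type u} {W : Type v} (X : SimpleGraph V) (Y : SimpleGraph W) :
    SimpleGraph (V × W) where
  Adj p q := (p.2 = q.2 ∧ X.Adj p.1 q.1) ∨ Y.Adj p.2 q.2
  symm := ⟨fun _ _ h => h.imp (fun h => ⟨h.1.symm, h.2.symm⟩) (fun h => h.symm)⟩
  loopless := ⟨fun _ h => h.elim (fun h => X.loopless.irrefl _ h.2) (fun h => Y.loopless.irrefl _ h)⟩

/-- `S_Y`: the pairs of distinct vertices with the same neighbours. -/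
def twinPairs {W : Type v} (Y : SimpleGraph W) : Set (W × W) :=
  {p | Y.neighborSet p.1 = Y.neighborSet p.2 ∧ p.1 ≠ p.2}

/-- `T_Y`: the pairs of distinct vertices `y₀`, `y₁` with `V(y₀) ∪ {y₀} = V(y₁) ∪ {y₁}`. -/
def closedTwinPairs {W : Type v} (Y : SimpleGraph W) : Set (W × W) :=
  {p | insert p.1 (Y.neighborSet p.1) = insert p.2 (Y.neighborSet p.2) ∧ p.1 ≠ p.2}

/-- The wreath product `Aut(X) ≀ Aut(Y)`, the semidirect product of `Aut(X)^W` by `Aut(Y)` for the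
action `(τ • σ) b = σ (τ⁻¹ b)`. -/
abbrev AutWreath {V : Type u} {W : Type v} (X : SimpleGraph V) (Y : SimpleGraph W) : Type (max u v) :=
  (W → (X ≃g X)) ⋊[mulAutArrow (G := Y ≃g Y) (A := W) (M := X ≃g X)] (Y ≃g Y)

end SimpleGraph

/-!
Characters see only the classical part of a quantum group: a unital `*`-homomorphism `A(X) → ℂ`
sends the generating magic unitary to a scalar magic unitary, that is to a permutation matrix, and
this matrix commutes with the adjacency matrix exactly when the permutation is an automorphism
of `X`. Over `ℂ` the commutation relations of a free wreath product hold automatically, so a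
character of `A(X) *_w A(Y)` is a family of automorphisms of `X`, one for each vertex of `Y`,
together with an automorphism of `Y`. An isomorphism `A(X ∘ Y) ≅ A(X) *_w A(Y)` therefore forces
`Aut(X ∘ Y)` and `Aut(X) ≀ Aut(Y)` to have the same order, and the canonical homomorphism is
bijective by counting.

In particular every automorphism of `X ∘ Y` permutes the copies of `X`. If `y₀` and `y₁` are twins
in `Y`, exchanging the two copies of a single connected component of `X` lying over `y₀` and `y₁` is
an automorphism, so `X` has only one component. Passing to complements turns closed twins into
twins.
-/

namespace CStarRelations

variable {G : Type u} {R : CStarRelations G}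

/-- The `*`-homomorphism from the universal C⋆-algebra given by its universal property, which is the
coordinate projection to the target of the realization. -/
noncomputable def Realization.lift (r : R.Realization) : R.Universal →⋆ₐ[ℂ] r.C where
  toFun a := (a : R.Ambient) r
  map_one' := rfl
  map_mul' _ _ := rfl
  map_zero' := rfl
  map_add' _ _ := rfl
  commutes' _ := rfl
  map_star' _ := rfl

@[simp]
theorem Realization.lift_gen (r : R.Realization) (x : G) : r.lift (R.gen x) = r.ρ x := rfl

theorem Universal.ext_lift {a b : R.Universal} (h : ∀ r : R.Realization, r.lift a = r.lift b) :
    a = b :=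
  Subtype.ext (lp.ext (funext h))

open scoped CStarAlgebra in
theorem Universal.starAlgHom_ext {B : Type*} [CStarAlgebra B] {φ ψ : R.Universal →⋆ₐ[ℂ] B}
    (h : ∀ x, φ (R.gen x) = ψ (R.gen x)) : φ = ψ := by
  have hφ : Continuous φ := map_continuous φ
  have hψ : Continuous ψ := map_continuous ψ
  refine StarAlgHom.ext_topologicalClosure hφ hψ (StarAlgHom.ext_adjoin ?_)
  rintro ⟨_, _⟩ ⟨x, rfl⟩
  exact h x

/-- The unital `*`-homomorphism `a ↦ gen (s a)`, for a family of generators `s` which the relations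
force to depend on its index through a unital `*`-homomorphism. -/
noncomputable def genHom {A : Type*} [CStarAlgebra A] (s : A → G)
    (hs : ∀ r : R.Realization, ∃ ψ : A →⋆ₐ[ℂ] r.C, ∀ a, r.ρ (s a) = ψ a) :
    A →⋆ₐ[ℂ] R.Universal where
  toFun a := R.gen (s a)
  map_one' := Universal.ext_lift fun r => by obtain ⟨ψ, h⟩ := hs r; simp [h]
  map_mul' _ _ := Universal.ext_lift fun r => by obtain ⟨ψ, h⟩ := hs r; simp [h]
  map_zero' := Universal.ext_lift fun r => by obtain ⟨ψ, h⟩ := hs r; simp [h]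
  map_add' _ _ := Universal.ext_lift fun r => by obtain ⟨ψ, h⟩ := hs r; simp [h]
  commutes' _ := Universal.ext_lift fun r => by
    obtain ⟨ψ, h⟩ := hs r; simp [h, AlgHomClass.commutes]
  map_star' _ := Universal.ext_lift fun r => by obtain ⟨ψ, h⟩ := hs r; simp [h, map_star]

/-- A copy of the C⋆-algebra `ℂ` in an arbitrary universe, since realizations have to live in the
universe of the generators. -/
abbrev Scalars : Type u := C(PUnit.{u + 1}, ℂ)

/-- The embedding of `ℂ` in its copy. -/
noncomputable def toScalars : ℂ →⋆ₐ[ℂ] Scalars.{u} :=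
  StarAlgHom.ofId ℂ Scalars.{u}

/-- The character of the universal C⋆-algebra with prescribed values on the generators. -/
noncomputable def character (ρ : G → ℂ) (h : R.Holds Scalars.{u} fun x => toScalars (ρ x)) :
    R.Universal →⋆ₐ[ℂ] ℂ :=
  (ContinuousMap.evalStarAlgHom ℂ ℂ PUnit.unit).comp
    (Realization.lift ⟨Scalars.{u}, fun x => toScalars (ρ x), h⟩)

end CStarRelations

open CStarRelations

theorem permMatrix_apply {n C : Type*} [DecidableEq n] [Zero C] [One C] (σ : Equiv.Perm n)
    (i j : n) : σ.permMatrix C i j = if σ i = j then 1 else 0 := by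
  simp [PEquiv.toMatrix_apply]

namespace IsMagicUnitary

variable {n : Type*} [Fintype n] {C D : Type*} [CStarAlgebra C] [CStarAlgebra D]

theorem map {m : Matrix n n C} (hm : IsMagicUnitary m) (φ : C →⋆ₐ[ℂ] D) :
    IsMagicUnitary (m.map φ) where
  proj i j := (hm.proj i j).map φ
  row_orth i j k h := by simp [← map_mul, hm.row_orth i j k h]
  col_orth i j k h := by simp [← map_mul, hm.col_orth i j k h]
  row_sum i := by simp [← map_sum, hm.row_sum i]
  col_sum j := by simp [← map_sum, hm.col_sum j]

theorem eq_zero_or_one {m : Matrix n n ℂ} (hm : IsMagicUnitary m) (i j : n) :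
    m i j = 0 ∨ m i j = 1 :=
  IsIdempotentElem.iff_eq_zero_or_one.mp (hm.proj i j).isIdempotentElem

theorem existsUnique_eq_one {m : Matrix n n ℂ} (hm : IsMagicUnitary m) (i : n) :
    ∃! j, m i j = 1 := by
  obtain ⟨j, -, hj⟩ : ∃ j ∈ Finset.univ, m i j ≠ 0 :=
    Finset.exists_ne_zero_of_sum_ne_zero (hm.row_sum i ▸ one_ne_zero)
  have hj : m i j = 1 := (hm.eq_zero_or_one i j).resolve_left hj
  refine ⟨j, hj, fun k hk => ?_⟩
  by_contra hne
  simpa [hj, hk] using hm.row_orth i k j hne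

variable [DecidableEq n]

theorem permMatrix (σ : Equiv.Perm n) : IsMagicUnitary (σ.permMatrix C) where
  proj i j := by
    rw [permMatrix_apply]
    split_ifs
    exacts [.one C, .zero C]
  row_orth i j k h := by
    simp only [permMatrix_apply]
    grind
  col_orth i j k h := by
    simp only [permMatrix_apply]
    grind [σ.injective.eq_iff]
  row_sum i := by simp
  col_sum j := by simp [← Equiv.eq_symm_apply]

theorem exists_eq_permMatrix {m : Matrix n n ℂ} (hm : IsMagicUnitary m) :
    ∃ σ : Equiv.Perm n, m = σ.permMatrix ℂ := by
  choose f hf hf_unique using hm.existsUnique_eq_one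
  have hf_inj : f.Injective := fun i j hij => by
    by_contra hne
    have := hm.col_orth i j (f i) hne
    rw [hf, hij, hf, one_mul] at this
    exact one_ne_zero this
  refine ⟨.ofBijective f (Finite.injective_iff_bijective.mp hf_inj), ?_⟩
  ext i j
  rw [permMatrix_apply, Equiv.ofBijective_apply]
  split_ifs with hij
  · exact hij ▸ hf i
  · exact (hm.eq_zero_or_one i j).resolve_right fun h => hij (hf_unique i j h).symm

end IsMagicUnitary

section AdjMatrix

variable {V : Type*} (X : SimpleGraph V) [DecidableRel X.Adj]

theorem adjMatrix_map {C D F : Type*} [NonAssocSemiring C] [NonAssocSemiring D] [FunLike F C D]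
    [RingHomClass F C D] (φ : F) : (X.adjMatrix C).map φ = X.adjMatrix D := by
  ext i j
  simp only [Matrix.map_apply, SimpleGraph.adjMatrix_apply, apply_ite φ, map_one, map_zero]

theorem adjMatrix_mul_permMatrix_comm_iff [Fintype V] [DecidableEq V] {C : Type*}
    [NonAssocSemiring C] [Nontrivial C] (σ : Equiv.Perm V) :
    X.adjMatrix C * σ.permMatrix C = σ.permMatrix C * X.adjMatrix C ↔
      ∀ i j, X.Adj (σ i) (σ j) ↔ X.Adj i j := by
  have entry (i j : V) : (X.adjMatrix C * σ.permMatrix C) i (σ j) =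
      (σ.permMatrix C * X.adjMatrix C) i (σ j) ↔ (X.Adj (σ i) (σ j) ↔ X.Adj i j) := by
    simp only [PEquiv.mul_toMatrix_toPEquiv, PEquiv.toMatrix_toPEquiv_mul, Matrix.submatrix_apply,
      SimpleGraph.adjMatrix_apply, id_eq, Equiv.symm_apply_apply]
    split_ifs <;> simp [*]
  simp only [← Matrix.ext_iff, ← entry]
  exact forall_congr' fun i => σ.surjective.forall

end AdjMatrix

namespace QAut

variable {V : Type u} [Fintype V] (X : SimpleGraph V)

theorem isMagicUnitary_u : IsMagicUnitary (QAut.u X) where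
  proj i j :=
    ⟨Universal.ext_lift fun r => (map_mul r.lift _ _).trans (r.holds.1.proj i j).isIdempotentElem,
      Universal.ext_lift fun r => (map_star r.lift _).trans (r.holds.1.proj i j).isSelfAdjoint⟩
  row_orth i j k h := Universal.ext_lift fun r => by
    rw [map_mul, map_zero]; exact r.holds.1.row_orth i j k h
  col_orth i j k h := Universal.ext_lift fun r => by
    rw [map_mul, map_zero]; exact r.holds.1.col_orth i j k h
  row_sum i := Universal.ext_lift fun r => by
    rw [map_sum, map_one]; exact r.holds.1.row_sum i
  col_sum j := Universal.ext_lift fun r => by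
    rw [map_sum, map_one]; exact r.holds.1.col_sum j

open Classical in
theorem adjMatrix_mul_u : X.adjMatrix (QAut X) * QAut.u X = QAut.u X * X.adjMatrix (QAut X) := by
  refine Matrix.ext fun i j => Universal.ext_lift fun r => ?_
  have h : (X.adjMatrix (QAut X) * QAut.u X).map r.lift =
      (QAut.u X * X.adjMatrix (QAut X)).map r.lift := by
    rw [Matrix.map_mul, Matrix.map_mul, adjMatrix_map]
    exact r.holds.2
  exact congrFun₂ h i j

variable {X}

open Classical in
theorem graphRelations_holds_permMatrix (C : Type u) [CStarAlgebra C] [Nontrivial C]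
    (σ : X ≃g X) :
    (graphRelations X).Holds C fun p => Equiv.Perm.permMatrix C σ.toEquiv p.1 p.2 :=
  ⟨.permMatrix σ.toEquiv,
    (adjMatrix_mul_permMatrix_comm_iff X σ.toEquiv).mpr fun _ _ => σ.map_adj_iff⟩

open Classical in
/-- The evaluation at an automorphism `σ`, a character of `A(X)`. It sends the generating magic
unitary to the permutation matrix of `σ`, with entries `1` at the positions `(i, σ i)`. -/
noncomputable def evalAut (σ : X ≃g X) : QAut X →⋆ₐ[ℂ] ℂ :=
  character (R := graphRelations X) (fun p => Equiv.Perm.permMatrix ℂ σ.toEquiv p.1 p.2) <| by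
    simpa only [permMatrix_apply, apply_ite toScalars, map_one, map_zero]
      using graphRelations_holds_permMatrix Scalars.{u} σ

open Classical in
theorem map_u_evalAut (σ : X ≃g X) :
    (QAut.u X).map (evalAut σ) = Equiv.Perm.permMatrix ℂ σ.toEquiv := rfl

theorem starAlgHom_ext {B : Type*} [CStarAlgebra B] {φ ψ : QAut X →⋆ₐ[ℂ] B}
    (h : (QAut.u X).map φ = (QAut.u X).map ψ) : φ = ψ :=
  Universal.starAlgHom_ext fun p => congrFun₂ h p.1 p.2

theorem evalAut_injective : Function.Injective (evalAut (X := X)) := fun σ τ h => by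
  classical
  have h : Equiv.Perm.permMatrix ℂ σ.toEquiv = Equiv.Perm.permMatrix ℂ τ.toEquiv := by
    rw [← map_u_evalAut, h, map_u_evalAut]
  refine RelIso.ext fun i => ?_
  simpa [permMatrix_apply, eq_comm] using congrFun₂ h i (σ i)

theorem evalAut_surjective : Function.Surjective (evalAut (X := X)) := fun φ => by
  classical
  obtain ⟨σ, hσ⟩ := ((isMagicUnitary_u X).map φ).exists_eq_permMatrix
  have hcomm : X.adjMatrix ℂ * σ.permMatrix ℂ = σ.permMatrix ℂ * X.adjMatrix ℂ := by
    rw [← hσ, ← adjMatrix_map X φ, ← Matrix.map_mul, ← Matrix.map_mul, adjMatrix_mul_u]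
  exact ⟨⟨σ, (adjMatrix_mul_permMatrix_comm_iff X σ).mp hcomm _ _⟩, starAlgHom_ext hσ.symm⟩

/-- The characters of `A(X)` are the evaluations at the automorphisms of `X`. -/
noncomputable def autEquivCharacter : (X ≃g X) ≃ (QAut X →⋆ₐ[ℂ] ℂ) :=
  .ofBijective evalAut ⟨evalAut_injective, evalAut_surjective⟩

end QAut

namespace FreeWreath

variable {A : Type u} [CStarAlgebra A] {n : Type w} {H : Type v} [CStarAlgebra H]
  (m : Matrix n n H)

/-- The canonical map `ν k` from the `k`-th copy of `A` to `A *_w H`. -/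
noncomputable def ν (k : n) : A →⋆ₐ[ℂ] FreeWreath A m :=
  genHom (fun a => Sum.inl (k, a)) fun r => by
    obtain ⟨ν, _, hν, -⟩ := r.holds
    exact ⟨ν k, hν k⟩

/-- The canonical map from `H` to `A *_w H`. -/
noncomputable def μ : H →⋆ₐ[ℂ] FreeWreath A m :=
  genHom Sum.inr fun r => by
    obtain ⟨_, μ, -, hμ, -⟩ := r.holds
    exact ⟨μ, hμ⟩

/-- A character of `A *_w H` is a family of characters of `A` together with a character of `H`. -/
noncomputable def characterEquiv :
    (FreeWreath A m →⋆ₐ[ℂ] ℂ) ≃ (n → (A →⋆ₐ[ℂ] ℂ)) × (H →⋆ₐ[ℂ] ℂ) where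
  toFun φ := (fun k => φ.comp (ν m k), φ.comp (μ m))
  invFun p := character (R := freeWreathRelations A m) (Sum.elim (fun q => p.1 q.1 q.2) p.2)
    ⟨fun k => toScalars.comp (p.1 k), toScalars.comp p.2, fun _ _ => rfl, fun _ => rfl,
      fun _ _ _ => mul_comm _ _⟩
  left_inv φ := Universal.starAlgHom_ext <| by rintro (_ | _) <;> rfl
  right_inv p := rfl

end FreeWreath

section Twins

variable {V W : Type*} {X : SimpleGraph V} {Y : SimpleGraph W}

theorem adj_iff_of_neighborSet_eq {a a' b b' : W} (ha : Y.neighborSet a = Y.neighborSet a')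
    (hb : Y.neighborSet b = Y.neighborSet b') : Y.Adj a b ↔ Y.Adj a' b' := by
  rw [← Y.mem_neighborSet, ha, Y.mem_neighborSet, Y.adj_comm, ← Y.mem_neighborSet, hb,
    Y.mem_neighborSet, Y.adj_comm]

theorem nontrivial_aut_of_twinPairs_nonempty (hY : Y.twinPairs.Nonempty) :
    Nontrivial (Y ≃g Y) := by
  classical
  obtain ⟨⟨y₀, y₁⟩, htwin, hne⟩ := hY
  let swapIso : Y ≃g Y := ⟨Equiv.swap y₀ y₁, adj_iff_of_neighborSet_eq
    (Equiv.apply_swap_eq_self htwin _) (Equiv.apply_swap_eq_self htwin _)⟩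
  refine ⟨swapIso, 1, fun h => hne ?_⟩
  calc y₀ = swapIso y₀ := (DFunLike.congr_fun h y₀).symm
    _ = y₁ := Equiv.swap_apply_left y₀ y₁

theorem twinPairs_compl (Y : SimpleGraph W) : Yᶜ.twinPairs = Y.closedTwinPairs := by
  ext ⟨a, b⟩
  simp only [SimpleGraph.twinPairs, SimpleGraph.closedTwinPairs, Set.mem_ofPred_eq, Set.ext_iff,
    Set.mem_insert_iff, SimpleGraph.mem_neighborSet, SimpleGraph.compl_adj]
  grind

theorem lexProd_compl (X : SimpleGraph V) (Y : SimpleGraph W) :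
    (X.lexProd Y)ᶜ = Xᶜ.lexProd Yᶜ := by
  ext ⟨i, a⟩ ⟨j, b⟩
  simp only [SimpleGraph.lexProd, SimpleGraph.compl_adj, ne_eq, Prod.mk.injEq]
  grind [Y.irrefl]

/-- A graph and its complement have the same automorphisms. -/
def autEquivAutCompl (X : SimpleGraph V) : (X ≃g X) ≃ (Xᶜ ≃g Xᶜ) where
  toFun f := ⟨f.toEquiv, (SimpleGraph.Embedding.complEquiv f.toEmbedding).map_adj_iff⟩
  invFun f := ⟨f.toEquiv, (SimpleGraph.Embedding.complEquiv.symm f.toEmbedding).map_adj_iff⟩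
  left_inv _ := rfl
  right_inv _ := rfl

/-- The automorphism of `X ∘ Y` that applies the permutation `t c` of the vertices of `Y` to the
copies of the connected component `c` of `X`, where every `t c` moves vertices to twins. -/
def componentwiseIso (t : X.ConnectedComponent → Equiv.Perm W)
    (ht : ∀ c a, Y.neighborSet (t c a) = Y.neighborSet a) : X.lexProd Y ≃g X.lexProd Y where
  toEquiv := Equiv.prodShear (Equiv.refl V) fun i => t (X.connectedComponentMk i)
  map_rel_iff' := by
    rintro ⟨i, a⟩ ⟨j, b⟩
    refine or_congr (and_congr_left fun (hij : X.Adj i j) => ?_)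
      (adj_iff_of_neighborSet_eq (ht _ a) (ht _ b))
    change t (X.connectedComponentMk i) a = t (X.connectedComponentMk j) b ↔ a = b
    rw [SimpleGraph.ConnectedComponent.connectedComponentMk_eq_of_adj hij,
      EmbeddingLike.apply_eq_iff_eq]

theorem preconnected_of_twinPairs_nonempty
    (hfiber : ∀ (f : X.lexProd Y ≃g X.lexProd Y) (i j : V) (a : W), (f (i, a)).2 = (f (j, a)).2)
    (hY : Y.twinPairs.Nonempty) : X.Preconnected := by
  classical
  obtain ⟨⟨y₀, y₁⟩, htwin, hne⟩ := hY
  intro i j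
  by_contra hij
  let t : X.ConnectedComponent → Equiv.Perm W :=
    Function.update 1 (X.connectedComponentMk i) (Equiv.swap y₀ y₁)
  have ht (c : X.ConnectedComponent) (a : W) : Y.neighborSet (t c a) = Y.neighborSet a := by
    obtain rfl | hc := eq_or_ne c (X.connectedComponentMk i)
    · simp only [t, Function.update_self, Equiv.apply_swap_eq_self htwin]
    · simp only [t, Function.update_of_ne hc, Pi.one_apply, Equiv.Perm.one_apply]
  have hti : t (X.connectedComponentMk i) y₀ = y₁ := by simp [t]
  have htj : t (X.connectedComponentMk j) y₀ = y₀ := by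
    have hji : X.connectedComponentMk j ≠ X.connectedComponentMk i :=
      fun h => hij (SimpleGraph.ConnectedComponent.exact h).symm
    simp [t, Function.update_of_ne hji]
  exact hne (htj.symm.trans ((hfiber (componentwiseIso t ht) i j y₀).symm.trans hti))

end Twins

section WreathHom

variable {V : Type u} {W : Type v} {X : SimpleGraph V} {Y : SimpleGraph W}

/-- The automorphism of `X ∘ Y` that applies `τ` to the second coordinate and `σ b` on the copy
of `X` arriving over `b`. -/
def lexProdIso (σ : W → (X ≃g X)) (τ : Y ≃g Y) : X.lexProd Y ≃g X.lexProd Y where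
  toFun p := (σ (τ p.2) p.1, τ p.2)
  invFun p := ((σ p.2)⁻¹ p.1, τ⁻¹ p.2)
  left_inv p := by simp
  right_inv p := by simp
  map_rel_iff' := by
    rintro ⟨i, a⟩ ⟨j, b⟩
    simp only [SimpleGraph.lexProd, Equiv.coe_fn_mk, EmbeddingLike.apply_eq_iff_eq,
      SimpleGraph.Iso.map_adj_iff]
    refine or_congr_left (and_congr_right ?_)
    rintro rfl
    exact (σ (τ a)).map_adj_iff

variable (X Y) in
/-- The canonical homomorphism `Aut(X) ≀ Aut(Y) → Aut(X ∘ Y)`. -/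
def wreathHom : X.AutWreath Y →* (X.lexProd Y ≃g X.lexProd Y) :=
  MonoidHom.mk' (fun g => lexProdIso g.left g.right) fun g h => RelIso.ext fun p => by
    have hinv : g.right⁻¹ (g.right (h.right p.2)) = h.right p.2 := g.right.symm_apply_apply _
    refine Prod.ext ?_ rfl
    change g.left _ (h.left (g.right⁻¹ (g.right (h.right p.2))) p.1) = _
    rw [hinv]
    rfl

theorem wreathHom_apply (g : X.AutWreath Y) (i : V) (a : W) :
    wreathHom X Y g (i, a) = (g.left (g.right a) i, g.right a) := rfl

theorem wreathHom_injective_of_nonempty [Nonempty V] :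
    Function.Injective (wreathHom X Y) := fun g h hgh => by
  have happly (i : V) (a : W) :
      (g.left (g.right a) i, g.right a) = (h.left (h.right a) i, h.right a) :=
    DFunLike.congr_fun hgh (i, a)
  have hright : g.right = h.right :=
    RelIso.ext fun a => congrArg Prod.snd (happly (Classical.arbitrary V) a)
  refine SemidirectProduct.ext (funext fun b => RelIso.ext fun i => ?_) hright
  simpa [← hright] using congrArg Prod.fst (happly i (g.right⁻¹ b))

theorem nonempty_of_wreathHom_injective [Nontrivial (Y ≃g Y)]
    (h : Function.Injective (wreathHom X Y)) : Nonempty V := by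
  by_contra hV
  rw [not_nonempty_iff] at hV
  have : Subsingleton (X.lexProd Y ≃g X.lexProd Y) := DFunLike.coe_injective.subsingleton
  have := (h.comp SemidirectProduct.inr_injective).subsingleton
  exact false_of_nontrivial_of_subsingleton (Y ≃g Y)

theorem connected_of_twinPairs_nonempty (h : Function.Bijective (wreathHom X Y))
    (hY : Y.twinPairs.Nonempty) : X.Connected := by
  have := nontrivial_aut_of_twinPairs_nonempty hY
  have := nonempty_of_wreathHom_injective h.injective
  refine ⟨preconnected_of_twinPairs_nonempty (fun f i j a => ?_) hY⟩
  obtain ⟨g, rfl⟩ := h.surjective f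
  rfl

theorem card_autWreath_compl (X : SimpleGraph V) (Y : SimpleGraph W) :
    Nat.card (Xᶜ.AutWreath Yᶜ) = Nat.card (X.AutWreath Y) :=
  Nat.card_congr <| SemidirectProduct.equivProd.trans <|
    (Equiv.prodCongr (.piCongrRight fun _ => autEquivAutCompl X) (autEquivAutCompl Y)).symm.trans
      SemidirectProduct.equivProd.symm

variable [Finite V] [Finite W]

theorem wreathHom_bijective_of_card_eq
    (hcard : Nat.card (X.AutWreath Y) = Nat.card (X.lexProd Y ≃g X.lexProd Y)) :
    Function.Bijective (wreathHom X Y) := by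
  have : Finite (X.lexProd Y ≃g X.lexProd Y) := DFunLike.finite _
  suffices Function.Injective (wreathHom X Y) from this.bijective_of_nat_card_le hcard.ge
  obtain _ | _ := isEmpty_or_nonempty V
  · have : Unique (X.lexProd Y ≃g X.lexProd Y) :=
      @Unique.mk' _ _ DFunLike.coe_injective.subsingleton
    have := (Nat.card_eq_one_iff_unique.mp (hcard.trans Nat.card_unique)).1
    exact Function.injective_of_subsingleton _
  · exact wreathHom_injective_of_nonempty

theorem mainTheorem2_general (X : SimpleGraph V) (Y : SimpleGraph W)
    (hcard : Nat.card (X.AutWreath Y) = Nat.card (X.lexProd Y ≃g X.lexProd Y)) :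
    (∃ e : X.AutWreath Y ≃* (X.lexProd Y ≃g X.lexProd Y),
      ∀ (g : X.AutWreath Y) (i : V) (a : W),
        e g (i, a) = (g.left (g.right a) i, g.right a)) ∧
    (Y.twinPairs.Nonempty → X.Connected) ∧
    (Y.closedTwinPairs.Nonempty → Xᶜ.Connected) := by
  have hbij := wreathHom_bijective_of_card_eq hcard
  have hcard_compl : Nat.card (Xᶜ.AutWreath Yᶜ) =
      Nat.card (Xᶜ.lexProd Yᶜ ≃g Xᶜ.lexProd Yᶜ) := by
    rw [card_autWreath_compl, hcard, ← lexProd_compl]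
    exact Nat.card_congr (autEquivAutCompl _)
  refine ⟨⟨.ofBijective _ hbij, wreathHom_apply⟩, connected_of_twinPairs_nonempty hbij, ?_⟩
  rw [← twinPairs_compl]
  exact connected_of_twinPairs_nonempty (wreathHom_bijective_of_card_eq hcard_compl)

end WreathHom

theorem card_autWreath_eq_card_aut_lexProd {V : Type u} {W : Type v} [Fintype V] [Fintype W]
    {X : SimpleGraph V} {Y : SimpleGraph W}
    (f : QAut (X.lexProd Y) ≃⋆ₐ[ℂ] FreeWreath (QAut X) (QAut.u Y)) :
    Nat.card (X.AutWreath Y) = Nat.card (X.lexProd Y ≃g X.lexProd Y) :=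
  Nat.card_congr <| calc
    X.AutWreath Y ≃ (W → (X ≃g X)) × (Y ≃g Y) := SemidirectProduct.equivProd
    _ ≃ (W → (QAut X →⋆ₐ[ℂ] ℂ)) × (QAut Y →⋆ₐ[ℂ] ℂ) :=
      .prodCongr (.piCongrRight fun _ => QAut.autEquivCharacter) QAut.autEquivCharacter
    _ ≃ (FreeWreath (QAut X) (QAut.u Y) →⋆ₐ[ℂ] ℂ) := (FreeWreath.characterEquiv _).symm
    _ ≃ (QAut (X.lexProd Y) →⋆ₐ[ℂ] ℂ) := f.symm.arrowCongr (.refl ℂ ℂ)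
    _ ≃ (X.lexProd Y ≃g X.lexProd Y) := QAut.autEquivCharacter.symm

theorem mainTheorem2 {V : Type u} {W : Type v} [Fintype V] [Fintype W]
    (X : SimpleGraph V) (Y : SimpleGraph W)
    (hiso : Nonempty (QAut (X.lexProd Y) ≃⋆ₐ[ℂ] FreeWreath (QAut X) (QAut.u Y))) :
    (∃ e : X.AutWreath Y ≃* (X.lexProd Y ≃g X.lexProd Y),
      ∀ (g : X.AutWreath Y) (i : V) (a : W),
        e g (i, a) = (g.left (g.right a) i, g.right a)) ∧
    (Y.twinPairs.Nonempty → X.Connected) ∧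
    (Y.closedTwinPairs.Nonempty → Xᶜ.Connected) := by
  obtain ⟨f⟩ := hiso
  exact mainTheorem2_general X Y (card_autWreath_eq_card_aut_lexProd f)
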